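/- Let $f:X\to X$ be a continuous map on a compact metric space with finite topological entropy, let $\mathcal M$ be the set of $f$-invariant Borel probability measures with the weak$^*$ topology, and assume that the entropy map $\mu\mapsto h_\mu(f)$ is upper semi-continuous on $\mathcal M$. Let $\Phi=(\phi_1,\dots,\phi_m):X\to\mathbb R^m$ be continuous. For $\mu\in\mathcal M$ put $\mathrm{rv}(\mu)=(\int\phi_1\,d\mu,\dots,\int\phi_m\,d\mu)$, and let $\mathrm{Rot}(\Phi)=\{\mathrm{rv}(\mu):\mu\in\mathcal M\}$ be the rotation set. For a unit vector $\alpha\in\mathbb R^m$ let $H_\alpha(\Phi)$ be the supporting hyperplane of $\mathrm{Rot}(\Phi)$ whose normal $\alpha$ points away from $\mathrm{Rot}(\Phi)$, and let $F_\alpha(\Phi)=\mathrm{Rot}(\Phi)\cap H_\alpha(\Phi)$; for $w\in\partial\,\mathrm{Rot}(\Phi)$ let $\gamma(w)$ be the set of unit vectors $\alpha$ with $w\in H_\alpha(\Phi)$. For continuous $\varphi:X\to\mathbb R$ let $ES(\varphi)$ be the set of $\mu\in\mathcal M$ with $h_\mu(f)+\int\varphi\,d\mu=\sup_{\nu\in\mathcal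 M}\bigl(h_\nu(f)+\int\varphi\,d\nu\bigr)$. The set $GS(\alpha)$ of ground states in direction $\alpha$ consists of all $\mu\in\mathcal M$ for which there are an increasing sequence $t_n\to\infty$ and $\mu_n\in ES(t_n\,\alpha\cdot\Phi)$ with $\mu_n\to\mu$. Let $w\in\partial\,\mathrm{Rot}(\Phi)$ be an exposed point of $\mathrm{Rot}(\Phi)$, that is, $\{w\}=\mathrm{Rot}(\Phi)\cap H$ for some supporting hyperplane $H$. 1. For every $\alpha\in\gamma(w)$ with $F_\alpha(\Phi)=\{w\}$ and every $\mu\in GS(\alpha)$ we have $\mathrm{rv}(\mu)=w$ and $h_\mu(f)=\sup\{h_\nu(f):\nu\in\mathcal M,\ \mathrm{rv}(\nu)=w\}$. 2. Suppose that there is exactly one measure $\mu\in\mathcal M$ with $\mathrm{rv}(\mu)=w$ and $h_\mu(f)=\sup\{h_\nu(f):\nu\in\mathcal M,\ \mathrm{rv}(\nu)=w\}$. Then $GS(\alpha)=\{\mu\}$ for every $\alpha\in\gamma(w)$ with $F_\alpha(\Phi)=\{w\}$. In particular, for such $\alpha$, if $ES(t\,\alpha\cdot\Phi)$ is a singleton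 $\{\mu_t\}$ for all large enough $t$, then $\mu_t\to\mu$ in the weak$^*$ topology as $t\to\infty$, that is, $\mu$ is the zero-temperature measure in the direction of $\alpha$. -/

import Mathlib

open Filter Topology MeasureTheory

noncomputable section

namespace RotEntropy

section Entropy

variable {X : Type*} [MeasurableSpace X]

/-- Shannon entropy `-∑ₐ μ(ξ = a) log μ(ξ = a)` of the finite partition of `X` into the
level sets of `ξ : X → ι`. -/
def partitionEntropy {ι : Type*} [Fintype ι] (μ : Measure X) (ξ : X → ι) : ℝ :=
  ∑ a, Real.negMulLog (μ.real (ξ ⁻¹' {a}))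

/-- Labelling of the join `⋁_{i < n} f^{-i} ξ`: the `n`-step itinerary of a point. -/
def itinerary {ι : Type*} (f : X → X) (ξ : X → ι) (n : ℕ) (x : X) : Fin n → ι :=
  fun i => ξ (f^[i] x)

/-- `h_μ(f, ξ) = lim (1/n) H_μ(⋁_{i < n} f^{-i} ξ)`; for invariant `μ` the limit exists, so it is
the upper limit. -/
def entropyOfPartition {ι : Type*} [Fintype ι] (f : X → X) (μ : Measure X) (ξ : X → ι) : EReal :=
  limsup (fun n : ℕ => ((partitionEntropy μ (itinerary f ξ n) / n : ℝ) : EReal)) atTop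

/-- Measure-theoretic (Kolmogorov–Sinai) entropy `h_μ(f)`: the supremum of `h_μ(f, ξ)` over all
finite measurable partitions, a partition being given by a measurable labelling. -/
def entropy (f : X → X) (μ : Measure X) : EReal :=
  ⨆ (k : ℕ) (ξ : X → Fin k) (_ : Measurable ξ), entropyOfPartition f μ ξ

/-- The set `M` of `f`-invariant probability measures. -/
def invariantMeasures (f : X → X) : Set (ProbabilityMeasure X) :=
  {μ | MeasurePreserving f (μ : Measure X) (μ : Measure X)}

/-- Free energy `h_μ(f) + ∫ φ dμ`. -/
def freeEnergy (f : X → X) (φ : X → ℝ) (μ : ProbabilityMeasure X) : EReal :=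
  entropy f (μ : Measure X) + ((∫ x, φ x ∂(μ : Measure X) : ℝ) : EReal)

/-- `ES(φ)`: invariant measures attaining `sup {h_ν(f) + ∫ φ dν : ν ∈ M}`. -/
def equilibriumStates (f : X → X) (φ : X → ℝ) : Set (ProbabilityMeasure X) :=
  {μ | μ ∈ invariantMeasures f ∧
    freeEnergy f φ μ = ⨆ ν ∈ invariantMeasures f, freeEnergy f φ ν}

variable [TopologicalSpace X] [OpensMeasurableSpace X]

/-- `GS(φ)`: weak* limits of equilibrium states of `t_n φ` along increasing `t_n → ∞`. -/
def groundStates (f : X → X) (φ : X → ℝ) : Set (ProbabilityMeasure X) :=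
  {μ | μ ∈ invariantMeasures f ∧
    ∃ (t : ℕ → ℝ) (ν : ℕ → ProbabilityMeasure X),
      StrictMono t ∧ Tendsto t atTop atTop ∧
      (∀ n, ν n ∈ equilibriumStates f (fun x => t n * φ x)) ∧
      Tendsto ν atTop (𝓝 μ)}

/-- `μ` is the zero-temperature measure of `φ`: for all `t ≥ t₀` the potential `t φ` has exactly
one equilibrium state `ν t`, and `ν t → μ` in the weak* topology as `t → ∞`. -/
def IsZeroTemperatureMeasure (f : X → X) (φ : X → ℝ) (μ : ProbabilityMeasure X) : Prop :=
  μ ∈ invariantMeasures f ∧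
    ∃ (t₀ : ℝ) (ν : ℝ → ProbabilityMeasure X), 0 ≤ t₀ ∧
      (∀ t, t₀ ≤ t → equilibriumStates f (fun x => t * φ x) = {ν t}) ∧
      Tendsto ν atTop (𝓝 μ)

end Entropy

section Convex

variable {m : ℕ}

/-- The hyperplane `{u : α · u = a}`. -/
def hyperplane (α : EuclideanSpace ℝ (Fin m)) (a : ℝ) : Set (EuclideanSpace ℝ (Fin m)) :=
  {u | inner ℝ α u = a}

/-- The hyperplane `{u : α · u = a}` cuts `K`: both open half spaces contain points of `K`. -/
def Cuts (α : EuclideanSpace ℝ (Fin m)) (a : ℝ) (K : Set (EuclideanSpace ℝ (Fin m))) : Prop :=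
  (∃ v ∈ K, inner ℝ α v < a) ∧ (∃ v ∈ K, a < inner ℝ α v)

/-- The hyperplane `{u : α · u = a}` supports `K`: it has distance zero to `K` and does not
cut `K`. -/
def IsSupporting (α : EuclideanSpace ℝ (Fin m)) (a : ℝ)
    (K : Set (EuclideanSpace ℝ (Fin m))) : Prop :=
  α ≠ 0 ∧ (⨅ v ∈ K, Metric.infEDist v (hyperplane α a)) = 0 ∧ ¬ Cuts α a K

/-- A face of `K` is the intersection of `K` with a supporting hyperplane. -/
def IsFace (K F : Set (EuclideanSpace ℝ (Fin m))) : Prop :=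
  ∃ α a, IsSupporting α a K ∧ F = K ∩ hyperplane α a

/-- `w` is an exposed point of `K`: `{w}` is a face of `K`. -/
def IsExposedPoint (K : Set (EuclideanSpace ℝ (Fin m))) (w : EuclideanSpace ℝ (Fin m)) : Prop :=
  w ∈ K ∧ IsFace K {w}

/-- The supporting hyperplane of `K` whose normal `α` points away from `K`, i.e. such that the
open half space `{v : a < α · v}` into which `α` points does not meet `K`.  (The number `a` is
unique when `K` is non-empty and bounded.) -/
def supportingHyperplane (K : Set (EuclideanSpace ℝ (Fin m))) (α : EuclideanSpace ℝ (Fin m)) :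
    Set (EuclideanSpace ℝ (Fin m)) :=
  {u | ∃ a, IsSupporting α a K ∧ (∀ v ∈ K, ¬ a < inner ℝ α v) ∧ u ∈ hyperplane α a}

end Convex

section Rotation

variable {X : Type*} [MeasurableSpace X] {m : ℕ}

/-- Rotation vector `rv(μ) = (∫ φ₁ dμ, …, ∫ φ_m dμ)`. -/
def rv (Φ : X → EuclideanSpace ℝ (Fin m)) (μ : ProbabilityMeasure X) :
    EuclideanSpace ℝ (Fin m) :=
  WithLp.toLp 2 (fun i => ∫ x, Φ x i ∂(μ : Measure X))

/-- The rotation set `Rot(Φ) = {rv(μ) : μ ∈ M}`. -/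
def Rot (f : X → X) (Φ : X → EuclideanSpace ℝ (Fin m)) : Set (EuclideanSpace ℝ (Fin m)) :=
  rv Φ '' invariantMeasures f

/-- The rotation class of `w`: invariant measures with rotation vector `w`. -/
def rotationClass (f : X → X) (Φ : X → EuclideanSpace ℝ (Fin m))
    (w : EuclideanSpace ℝ (Fin m)) : Set (ProbabilityMeasure X) :=
  {μ | μ ∈ invariantMeasures f ∧ rv Φ μ = w}

/-- Localized entropy `H(w) = sup {h_μ(f) : μ ∈ M, rv(μ) = w}`. -/
def localizedEntropy (f : X → X) (Φ : X → EuclideanSpace ℝ (Fin m))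
    (w : EuclideanSpace ℝ (Fin m)) : EReal :=
  ⨆ μ ∈ rotationClass f Φ w, entropy f (μ : Measure X)

/-- The localized measures of maximal entropy at `w`. -/
def localizedMaxEntropyMeasures (f : X → X) (Φ : X → EuclideanSpace ℝ (Fin m))
    (w : EuclideanSpace ℝ (Fin m)) : Set (ProbabilityMeasure X) :=
  {μ | μ ∈ rotationClass f Φ w ∧ entropy f (μ : Measure X) = localizedEntropy f Φ w}

/-- The face `F_α(Φ) = Rot(Φ) ∩ H_α(Φ)`. -/
def face (f : X → X) (Φ : X → EuclideanSpace ℝ (Fin m)) (α : EuclideanSpace ℝ (Fin m)) :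
    Set (EuclideanSpace ℝ (Fin m)) :=
  Rot f Φ ∩ supportingHyperplane (Rot f Φ) α

/-- `γ(w)`: the direction vectors (unit vectors) `α` with `w ∈ H_α(Φ)`. -/
def directionVectors (f : X → X) (Φ : X → EuclideanSpace ℝ (Fin m))
    (w : EuclideanSpace ℝ (Fin m)) : Set (EuclideanSpace ℝ (Fin m)) :=
  {α | ‖α‖ = 1 ∧ w ∈ supportingHyperplane (Rot f Φ) α}

/-- The one-dimensional potential `α · Φ`. -/
def dotPotential (α : EuclideanSpace ℝ (Fin m)) (Φ : X → EuclideanSpace ℝ (Fin m)) : X → ℝ :=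
  fun x => inner ℝ α (Φ x)

end Rotation

end RotEntropy

end

/-! Since `h_ν(f) + t ∫ φ dν` is `t` times `∫ φ dν + h_ν(f) / t` and the entropy is bounded above
near a limit point by upper semicontinuity, limits of equilibrium states of `t φ` as `t → ∞` first
maximise `∫ φ dν`, and among the maximisers of the integral they maximise the entropy. For
`φ = α · Φ` the integral is `α · rv(ν)`, so if `F_α(Φ) = {w}` its maximisers are the invariant
measures with rotation vector `w`. When the measure of maximal entropy among them is unique,
compactness of the set of invariant measures turns uniqueness of the cluster point into convergence.

This comparison needs `h_μ(f) < ∞`. Off a set `B` of small measure, the label `ξ x` of a finite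
partition `ξ : X → ι` can be read off from any point close enough to `x`. So the `n`-step itinerary
of `x` differs from that of a nearby orbit of a spanning set only at visits to `B`; recording the
orbit, the times at which the two differ and the correct symbols there gives
`h_μ(f, ξ) ≤ h_top(f) + log 2 + μ(B) log #ι`. -/

namespace RotEntropy

section FiniteDistributions

theorem sum_negMulLog_add_sum_mul_log_le_log_sum {ι : Type*} [Fintype ι] {p v : ι → ℝ}
    (hp : ∀ a, 0 ≤ p a) (hp1 : ∑ a, p a = 1) (hv : ∀ a, 0 < v a) :
    ∑ a, Real.negMulLog (p a) + ∑ a, p a * Real.log (v a) ≤ Real.log (∑ a, v a) := by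
  set Z := ∑ a, v a with hZ
  have hZpos : 0 < Z := by
    refine Finset.sum_pos (fun a _ => hv a) (Finset.nonempty_of_ne_empty fun h => ?_)
    simp [h] at hp1
  have pointwise : ∀ a,
      Real.negMulLog (p a) + p a * Real.log (v a) ≤ v a / Z - p a + p a * Real.log Z := by
    intro a
    rcases (hp a).eq_or_lt with hpa | hpa
    · simpa [← hpa] using (div_pos (hv a) hZpos).le
    · have hlog := mul_le_mul_of_nonneg_left
        (Real.log_le_sub_one_of_pos (div_pos (hv a) (mul_pos hpa hZpos))) hpa.le
      have hcancel : p a * (v a / (p a * Z) - 1) = v a / Z - p a := by field_simp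
      rw [Real.log_div (hv a).ne' (mul_pos hpa hZpos).ne', Real.log_mul hpa.ne' hZpos.ne',
        hcancel] at hlog
      rw [Real.negMulLog]
      linarith
  calc ∑ a, Real.negMulLog (p a) + ∑ a, p a * Real.log (v a)
      ≤ ∑ a, (v a / Z - p a + p a * Real.log Z) := by
        rw [← Finset.sum_add_distrib]
        exact Finset.sum_le_sum fun a _ => pointwise a
    _ = Real.log Z := by
        rw [Finset.sum_add_distrib, Finset.sum_sub_distrib, ← Finset.sum_div, ← Finset.sum_mul,
          hp1, ← hZ, div_self hZpos.ne', sub_self, zero_add, one_mul]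

end FiniteDistributions

section Hamming

variable {κ ι R : Type*} [Fintype κ] [DecidableEq ι]

theorem pow_hammingDist [CommMonoid R] (r : R) (a b : κ → ι) :
    r ^ hammingDist a b = ∏ i, if a i = b i then 1 else r := by
  simp [hammingDist, Finset.prod_ite]

theorem sum_pow_hammingDist [DecidableEq κ] [Fintype ι] [CommRing R] (r : R) (b : κ → ι) :
    ∑ a : κ → ι, r ^ hammingDist a b = (1 + (Fintype.card ι - 1) * r) ^ Fintype.card κ := by
  have letter : ∀ j : ι, ∑ i, (if i = j then 1 else r) = 1 + (Fintype.card ι - 1) * r := by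
    intro j
    simp [Finset.sum_ite, Finset.filter_ne', Finset.filter_eq', Fintype.card_pos_iff.2 ⟨j⟩]
  simp_rw [pow_hammingDist, ← Fintype.prod_sum fun i j => if j = b i then 1 else r, letter]
  simp

theorem sum_inv_card_pow_hammingDist_le [DecidableEq κ] [Fintype ι] (b : κ → ι) :
    ∑ a : κ → ι, (Fintype.card ι : ℝ)⁻¹ ^ hammingDist a b ≤ 2 ^ Fintype.card κ := by
  have hinv : (Fintype.card ι : ℝ)⁻¹ ≤ 1 := Nat.cast_inv_le_one _
  have hinv' : 0 ≤ (Fintype.card ι : ℝ)⁻¹ := by positivity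
  have hmul : (Fintype.card ι : ℝ) * (Fintype.card ι : ℝ)⁻¹ ≤ 1 := mul_inv_le_one
  have hmul' : 0 ≤ (Fintype.card ι : ℝ) * (Fintype.card ι : ℝ)⁻¹ := by positivity
  rw [sum_pow_hammingDist]
  exact pow_le_pow_left₀ (by linarith) (by linarith) _

end Hamming

section Coding

variable {X : Type*} [MeasurableSpace X] {μ : Measure X} [IsProbabilityMeasure μ]

theorem partitionEntropy_add_integral_log_le_log_sum {ι : Type*} [Fintype ι] [MeasurableSpace ι]
    [MeasurableSingletonClass ι] {η : X → ι} (hη : Measurable η) {v : ι → ℝ}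
    (hv : ∀ a, 0 < v a) :
    partitionEntropy μ η + ∫ x, Real.log (v (η x)) ∂μ ≤ Real.log (∑ a, v a) := by
  have hmap : ∀ a, μ.real (η ⁻¹' {a}) = (μ.map η).real {a} := fun a =>
    (map_measureReal_apply hη (measurableSet_singleton a)).symm
  have : IsProbabilityMeasure (μ.map η) := Measure.isProbabilityMeasure_map hη.aemeasurable
  have hint : Integrable (fun a => Real.log (v a)) (μ.map η) := .of_finite
  have hlog : ∫ x, Real.log (v (η x)) ∂μ = ∑ a, μ.real (η ⁻¹' {a}) * Real.log (v a) := by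
    rw [← integral_map hη.aemeasurable hint.aestronglyMeasurable, integral_fintype hint]
    simp_rw [hmap, smul_eq_mul]
  rw [hlog]
  refine sum_negMulLog_add_sum_mul_log_le_log_sum (fun _ => measureReal_nonneg) ?_ hv
  simp_rw [hmap]
  simp

-- The weight `∑ b ∈ W, (#ι)⁻¹ ^ d(a, b)` of a word `a` is modelled on a code that names a codeword,
-- marks the positions of the errors (at most `log 2` per letter) and corrects each at the price
-- `log #ι`.
theorem partitionEntropy_le_of_hammingDist_le {κ ι : Type*} [Fintype κ] [DecidableEq κ]
    [Fintype ι] [DecidableEq ι] [MeasurableSpace ι] [MeasurableSingletonClass ι] {η : X → κ → ι}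
    (hη : Measurable η) (W : Finset (κ → ι)) {g : X → ℝ} (hg : Integrable g μ)
    (hW : ∀ x, ∃ b ∈ W, hammingDist (η x) b ≤ g x) :
    partitionEntropy μ η ≤
      Real.log W.card + Fintype.card κ * Real.log 2 +
        (∫ x, g x ∂μ) * Real.log (Fintype.card ι) := by
  obtain ⟨x₀⟩ : Nonempty X := nonempty_of_isProbabilityMeasure μ
  obtain ⟨b₀, hb₀, -⟩ := hW x₀
  set k : ℝ := (Fintype.card ι : ℝ)
  set v : (κ → ι) → ℝ := fun a => ∑ b ∈ W, k⁻¹ ^ hammingDist a b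
  have hterm : ∀ a b : κ → ι, 0 < k⁻¹ ^ hammingDist a b := fun a b => by
    rcases isEmpty_or_nonempty ι
    · simp [show a = b from funext fun i => isEmptyElim (a i)]
    · positivity
  have hv : ∀ a, 0 < v a := fun a => Finset.sum_pos (fun b _ => hterm a b) ⟨b₀, hb₀⟩
  have hsum : ∑ a, v a ≤ W.card * 2 ^ Fintype.card κ := by
    rw [Finset.sum_comm, ← nsmul_eq_mul]
    exact Finset.sum_le_card_nsmul _ _ _ fun b _ => sum_inv_card_pow_hammingDist_le b
  have hlog : ∀ x, -(g x * Real.log k) ≤ Real.log (v (η x)) := by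
    intro x
    obtain ⟨b, hb, hbx⟩ := hW x
    calc -(g x * Real.log k) ≤ -(hammingDist (η x) b * Real.log k) := by
          gcongr
      _ = Real.log (k⁻¹ ^ hammingDist (η x) b) := by rw [Real.log_pow, Real.log_inv, mul_neg]
      _ ≤ Real.log (v (η x)) := Real.log_le_log (hterm _ _)
          (Finset.single_le_sum (f := fun b => k⁻¹ ^ hammingDist (η x) b)
            (fun b _ => (hterm _ b).le) hb)
  have hint : Integrable (fun x => Real.log (v (η x))) μ :=
    (Integrable.of_finite (μ := μ.map η) (f := fun a => Real.log (v a))).comp_measurable hη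
  have hmono : -((∫ x, g x ∂μ) * Real.log k) ≤ ∫ x, Real.log (v (η x)) ∂μ := by
    rw [← integral_mul_const, ← integral_neg]
    exact integral_mono (hg.mul_const _).neg hint hlog
  have hlogsum : Real.log (∑ a, v a) ≤ Real.log W.card + Fintype.card κ * Real.log 2 := by
    rw [← Real.log_pow, ← Real.log_mul (by simpa using Finset.ne_empty_of_mem hb₀) (by positivity)]
    exact Real.log_le_log (Finset.sum_pos (fun a _ => hv a) ⟨b₀, Finset.mem_univ _⟩) hsum
  linarith [partitionEntropy_add_integral_log_le_log_sum (μ := μ) hη hv]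

end Coding

section BirkhoffSum

variable {X E : Type*} [MeasurableSpace X] [NormedAddCommGroup E] {f : X → X} {μ : Measure X}

theorem integrable_birkhoffSum (hf : MeasurePreserving f μ μ) {g : X → E} (hg : Integrable g μ)
    (n : ℕ) : Integrable (birkhoffSum f g n) μ :=
  integrable_finsetSum _ fun i _ => (hf.iterate i).integrable_comp_of_integrable hg

theorem integral_birkhoffSum [NormedSpace ℝ E] (hf : MeasurePreserving f μ μ) {g : X → E}
    (hg : Integrable g μ) (n : ℕ) : ∫ x, birkhoffSum f g n x ∂μ = n • ∫ x, g x ∂μ := by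
  have hiter : ∀ i, ∫ x, g (f^[i] x) ∂μ = ∫ x, g x ∂μ := fun i => by
    have hi := hf.iterate i
    have hg' : AEStronglyMeasurable g (μ.map f^[i]) := hi.map_eq.symm ▸ hg.aestronglyMeasurable
    rw [← integral_map hi.measurable.aemeasurable hg', hi.map_eq]
  have hint : ∀ i, Integrable (fun x => g (f^[i] x)) μ := fun i =>
    (hf.iterate i).integrable_comp_of_integrable hg
  simp_rw [birkhoffSum, integral_finsetSum _ fun i _ => hint i, hiter, Finset.sum_const,
    Finset.card_range]

end BirkhoffSum

section Itineraries

variable {X ι : Type*} {f : X → X}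

theorem hammingDist_itinerary_le_birkhoffSum [DecidableEq ι] {ξ ℓ : X → ι} {B : Set X} {n : ℕ}
    {x y : X} (h : ∀ i < n, f^[i] x ∉ B → ξ (f^[i] x) = ℓ (f^[i] y)) :
    (hammingDist (itinerary f ξ n x) (itinerary f ℓ n y) : ℝ) ≤
      birkhoffSum f (B.indicator 1) n x := by
  rw [hammingDist, Finset.natCast_card_filter, birkhoffSum, Finset.sum_range]
  refine Finset.sum_le_sum fun i _ => ?_
  by_cases hi : f^[i] x ∈ B
  · rw [Set.indicator_of_mem hi]
    split_ifs <;> simp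
  · have heq : itinerary f ξ n x i = itinerary f ℓ n y i := h i i.2 hi
    rw [Set.indicator_of_notMem hi, if_neg (not_not.2 heq)]

variable [MeasurableSpace X]

theorem measurable_itinerary [MeasurableSpace ι] (hf : Measurable f) {ξ : X → ι}
    (hξ : Measurable ξ) (n : ℕ) : Measurable (itinerary f ξ n) :=
  measurable_pi_lambda _ fun i => hξ.comp (hf.iterate i)

theorem partitionEntropy_itinerary_le [Fintype ι] [MeasurableSpace ι] [MeasurableSingletonClass ι]
    {μ : Measure X} [IsProbabilityMeasure μ] (hf : MeasurePreserving f μ μ) {ξ ℓ : X → ι}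
    (hξ : Measurable ξ) {B : Set X} (hB : MeasurableSet B) {n : ℕ} {s : Finset X}
    (hs : ∀ x, ∃ y ∈ s, ∀ i < n, f^[i] x ∉ B → ξ (f^[i] x) = ℓ (f^[i] y)) :
    partitionEntropy μ (itinerary f ξ n) ≤
      Real.log s.card + n * (Real.log 2 + μ.real B * Real.log (Fintype.card ι)) := by
  classical
  obtain ⟨x₀⟩ : Nonempty X := nonempty_of_isProbabilityMeasure μ
  obtain ⟨y₀, hy₀, -⟩ := hs x₀
  have hvisits : Integrable (B.indicator (1 : X → ℝ)) μ := (integrable_const 1).indicator hB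
  have hcode := partitionEntropy_le_of_hammingDist_le (measurable_itinerary hf.measurable hξ n)
    (s.image (itinerary f ℓ n)) (integrable_birkhoffSum hf hvisits n) fun x =>
      let ⟨y, hy, hxy⟩ := hs x
      ⟨_, Finset.mem_image_of_mem _ hy, hammingDist_itinerary_le_birkhoffSum hxy⟩
  have hcard : Real.log (s.image (itinerary f ℓ n)).card ≤ Real.log s.card :=
    Real.log_le_log (by exact_mod_cast Finset.card_pos.2 ⟨_, Finset.mem_image_of_mem _ hy₀⟩)
      (by exact_mod_cast Finset.card_image_le)
  rw [integral_birkhoffSum hf hvisits, integral_indicator_one hB, Fintype.card_fin,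
    nsmul_eq_mul] at hcode
  linarith

end Itineraries

section EntropyNonneg

variable {X : Type*} [MeasurableSpace X] (f : X → X) (μ : Measure X) [IsProbabilityMeasure μ]

theorem partitionEntropy_nonneg {ι : Type*} [Fintype ι] (ξ : X → ι) : 0 ≤ partitionEntropy μ ξ :=
  Finset.sum_nonneg fun _ _ => Real.negMulLog_nonneg measureReal_nonneg measureReal_le_one

theorem entropyOfPartition_nonneg {ι : Type*} [Fintype ι] (ξ : X → ι) :
    0 ≤ entropyOfPartition f μ ξ := by
  refine le_limsup_of_frequently_le (Frequently.of_forall fun n => ?_)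
  exact_mod_cast div_nonneg (partitionEntropy_nonneg μ _) n.cast_nonneg

theorem entropy_nonneg : 0 ≤ entropy f μ :=
  (entropyOfPartition_nonneg f μ fun _ => (0 : Fin 1)).trans
    (le_iSup_of_le 1 <| le_iSup_of_le _ <| le_iSup_of_le measurable_const le_rfl)

end EntropyNonneg

section Labels

theorem exists_mem_uniformity_forall_mem_imp_eq {X ι : Type*} [UniformSpace X] [CompactSpace X]
    [Finite ι] [Nonempty ι] {F : ι → Set X} (hF : ∀ j, IsClosed (F j))
    (hdisj : Pairwise (Function.onFun Disjoint F)) :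
    ∃ ℓ : X → ι, ∃ V ∈ uniformity X, ∀ x y, (x, y) ∈ V → ∀ j, x ∈ F j → ℓ y = j := by
  have hcover : ∀ x, ∃ j, x ∈ (⋃ i ∈ {i | i ≠ j}, F i)ᶜ := by
    intro x
    by_cases hx : ∃ j, x ∈ F j
    · obtain ⟨j, hj⟩ := hx
      exact ⟨j, by simpa using fun i hij hi => (hdisj hij).notMem_of_mem_left hi hj⟩
    · exact ⟨Classical.arbitrary ι, by simpa using fun i _ hi => hx ⟨i, hi⟩⟩
  obtain ⟨V, hV, hVF⟩ := lebesgue_number_lemma isCompact_univ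
    (fun j => ((Set.toFinite {i | i ≠ j}).isClosed_biUnion fun i _ => hF i).isOpen_compl)
    (fun x _ => Set.mem_iUnion.2 (hcover x))
  choose ℓ hℓ using fun y => hVF y (Set.mem_univ y)
  refine ⟨ℓ, Prod.swap ⁻¹' V, tendsto_swap_uniformity hV, fun x y hxy j hx => ?_⟩
  by_contra hne
  exact hℓ y hxy (Set.mem_biUnion (Ne.symm hne : j ∈ {i | i ≠ ℓ y}) hx)

theorem exists_isClosed_subset_preimage_measure_compl_iUnion_le {X ι : Type*} [TopologicalSpace X]
    [MeasurableSpace X] [OpensMeasurableSpace X] [Finite ι] [MeasurableSpace ι]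
    [MeasurableSingletonClass ι] (μ : Measure X) [IsFiniteMeasure μ] [μ.WeaklyRegular] {ξ : X → ι}
    (hξ : Measurable ξ) {ε : ENNReal} (hε : ε ≠ 0) :
    ∃ F : ι → Set X, (∀ j, IsClosed (F j)) ∧ (∀ j, F j ⊆ ξ ⁻¹' {j}) ∧ μ (⋃ j, F j)ᶜ ≤ ε := by
  obtain ⟨δ, hδ, hsum⟩ := ENNReal.exists_pos_sum_of_countable' hε ι
  choose F hsub hF hμF using fun j =>
    (hξ (measurableSet_singleton j)).exists_isClosed_sdiff_lt (μ := μ) (measure_ne_top _ _)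
      (hδ j).ne'
  refine ⟨F, hF, hsub, ?_⟩
  have huncovered : (⋃ j, F j)ᶜ ⊆ ⋃ j, ξ ⁻¹' {j} \ F j := fun x hx =>
    Set.mem_iUnion.2 ⟨ξ x, rfl, fun h => hx (Set.mem_iUnion.2 ⟨_, h⟩)⟩
  calc μ (⋃ j, F j)ᶜ ≤ ∑' j, μ (ξ ⁻¹' {j} \ F j) :=
        (measure_mono huncovered).trans (measure_iUnion_le _)
    _ ≤ ∑' j, δ j := ENNReal.tsum_le_tsum fun j => (hμF j).le
    _ ≤ ε := hsum.le

theorem exists_measurableSet_forall_mem_uniformity_eq {X ι : Type*} [UniformSpace X]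
    [CompactSpace X] [MeasurableSpace X] [OpensMeasurableSpace X] [Finite ι] [Nonempty ι]
    [MeasurableSpace ι] [MeasurableSingletonClass ι] (μ : Measure X) [IsFiniteMeasure μ]
    [μ.WeaklyRegular] {ξ : X → ι} (hξ : Measurable ξ) {ε : ℝ} (hε : 0 < ε) :
    ∃ B : Set X, MeasurableSet B ∧ μ.real B ≤ ε ∧
      ∃ ℓ : X → ι, ∃ V ∈ uniformity X, ∀ x y, (x, y) ∈ V → x ∉ B → ξ x = ℓ y := by
  obtain ⟨F, hF, hFξ, hμF⟩ := exists_isClosed_subset_preimage_measure_compl_iUnion_le μ hξ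
    (ENNReal.ofReal_pos.2 hε).ne'
  obtain ⟨ℓ, V, hV, hℓ⟩ := exists_mem_uniformity_forall_mem_imp_eq hF fun i j hij =>
    ((Set.disjoint_singleton.2 hij).preimage ξ).mono (hFξ i) (hFξ j)
  refine ⟨(⋃ j, F j)ᶜ, (isClosed_iUnion_of_finite hF).measurableSet.compl,
    ENNReal.toReal_le_of_le_ofReal hε.le hμF, ℓ, V, hV, fun x y hxy hx => ?_⟩
  obtain ⟨j, hj⟩ := Set.mem_iUnion.1 (not_not.1 hx)
  exact (hFξ j hj).trans (hℓ x y hxy j hj).symm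

end Labels

section TopologicalEntropy

variable {X : Type*} [UniformSpace X] [CompactSpace X] [MeasurableSpace X] {f : X → X}
  {μ : Measure X} [IsProbabilityMeasure μ] {ι : Type*} [Fintype ι] [MeasurableSpace ι]
  [MeasurableSingletonClass ι] {ξ : X → ι}

theorem partitionEntropy_itinerary_div_le (hf : MeasurePreserving f μ μ) (hξ : Measurable ξ)
    {B : Set X} (hB : MeasurableSet B) {ℓ : X → ι} {V : SetRel X X} (hV : V ∈ uniformity X)
    (hℓ : ∀ x y, (x, y) ∈ V → x ∉ B → ξ x = ℓ y) {n : ℕ} (hn : 0 < n) :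
    ((partitionEntropy μ (itinerary f ξ n) / n : ℝ) : EReal) ≤
      ENNReal.log (Dynamics.coverMincard f Set.univ V n) / n +
        (Real.log 2 + μ.real B * Real.log (Fintype.card ι) : ℝ) := by
  obtain ⟨s, hs, hcard⟩ := (Dynamics.coverMincard_finite_iff f Set.univ V n).1
    (Dynamics.coverMincard_finite_of_isCompact_invariant isCompact_univ (Set.mapsTo_univ f _) hV n)
  have hpredict : ∀ x, ∃ y ∈ s, ∀ i < n, f^[i] x ∉ B → ξ (f^[i] x) = ℓ (f^[i] y) := fun x =>
    let ⟨y, hy, hxy⟩ := hs (Set.mem_univ x)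
    ⟨y, hy, fun i hi => hℓ _ _ (Dynamics.mem_dynEntourage.1 hxy i hi)⟩
  obtain ⟨x₀⟩ : Nonempty X := nonempty_of_isProbabilityMeasure μ
  have hs0 : s.card ≠ 0 := let ⟨y, hy, _⟩ := hpredict x₀; Finset.card_ne_zero_of_mem hy
  have hlog : ENNReal.log (Dynamics.coverMincard f Set.univ V n) = Real.log s.card := by
    rw [← hcard, ENat.toENNReal_coe, ENNReal.log_pos_real (by exact_mod_cast hs0) (by simp),
      ENNReal.toReal_natCast]
  have hn' : (0 : ℝ) < n := Nat.cast_pos.2 hn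
  rw [hlog, ← EReal.coe_natCast, ← EReal.coe_div, ← EReal.coe_add, EReal.coe_le_coe_iff,
    div_add' _ _ _ hn'.ne', mul_comm _ (n : ℝ)]
  gcongr
  exact partitionEntropy_itinerary_le hf hξ hB hpredict

theorem entropyOfPartition_le_coverEntropyEntourage_add (hf : MeasurePreserving f μ μ)
    (hξ : Measurable ξ) {B : Set X} (hB : MeasurableSet B) {ℓ : X → ι} {V : SetRel X X}
    (hV : V ∈ uniformity X) (hℓ : ∀ x y, (x, y) ∈ V → x ∉ B → ξ x = ℓ y) :
    entropyOfPartition f μ ξ ≤ Dynamics.coverEntropyEntourage f Set.univ V +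
      (Real.log 2 + μ.real B * Real.log (Fintype.card ι) : ℝ) := by
  set c : ℝ := Real.log 2 + μ.real B * Real.log (Fintype.card ι)
  have hc : limsup (fun _ : ℕ => (c : EReal)) atTop = c := limsup_const _
  calc entropyOfPartition f μ ξ
      ≤ limsup ((fun n : ℕ => ENNReal.log (Dynamics.coverMincard f Set.univ V n) / n) +
          fun _ => (c : EReal)) atTop :=
        limsup_le_limsup ((eventually_gt_atTop 0).mono fun _ hn =>
          partitionEntropy_itinerary_div_le hf hξ hB hV hℓ hn)
    _ ≤ Dynamics.coverEntropyEntourage f Set.univ V + c := by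
        refine (EReal.limsup_add_le ?_ ?_).trans_eq (congrArg _ hc) <;> simp [hc]

variable [OpensMeasurableSpace X] [μ.WeaklyRegular]

theorem entropyOfPartition_le_coverEntropy_add_log_two (hf : MeasurePreserving f μ μ)
    (hξ : Measurable ξ) :
    entropyOfPartition f μ ξ ≤ Dynamics.coverEntropy f Set.univ + Real.log 2 := by
  obtain ⟨x₀⟩ : Nonempty X := nonempty_of_isProbabilityMeasure μ
  have : Nonempty ι := ⟨ξ x₀⟩
  set c : ℝ := Real.log (Fintype.card ι)
  have approx : ∀ δ > 0, entropyOfPartition f μ ξ ≤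
      Dynamics.coverEntropy f Set.univ + (Real.log 2 + δ * c : ℝ) := by
    intro δ hδ
    obtain ⟨B, hB, hμB, ℓ, V, hV, hℓ⟩ :=
      exists_measurableSet_forall_mem_uniformity_eq μ hξ hδ
    refine (entropyOfPartition_le_coverEntropyEntourage_add hf hξ hB hV hℓ).trans ?_
    gcongr
    exact Dynamics.coverEntropyEntourage_le_coverEntropy f _ hV
  have hlim : Tendsto (fun δ : ℝ => Dynamics.coverEntropy f Set.univ + (Real.log 2 + δ * c : ℝ))
      (𝓝[>] 0) (𝓝 (Dynamics.coverEntropy f Set.univ + Real.log 2)) := by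
    have hreal : Continuous fun δ : ℝ => ((Real.log 2 + δ * c : ℝ) : EReal) :=
      continuous_coe_real_ereal.comp (by fun_prop)
    have hadd := EReal.continuousAt_add (p := (Dynamics.coverEntropy f Set.univ, ↑(Real.log 2)))
      (Or.inr (EReal.coe_ne_bot _)) (Or.inr (EReal.coe_ne_top _))
    exact hadd.tendsto.comp (tendsto_const_nhds.prodMk_nhds
      ((hreal.tendsto' 0 _ (by simp)).mono_left nhdsWithin_le_nhds))
  exact ge_of_tendsto hlim (eventually_mem_nhdsWithin.mono approx)

theorem entropy_le_coverEntropy_add_log_two (hf : MeasurePreserving f μ μ) :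
    entropy f μ ≤ Dynamics.coverEntropy f Set.univ + Real.log 2 :=
  iSup₂_le fun _ _ => iSup_le fun hξ => entropyOfPartition_le_coverEntropy_add_log_two hf hξ

theorem entropy_lt_top (hf : MeasurePreserving f μ μ)
    (htop : Dynamics.coverEntropy f Set.univ < ⊤) : entropy f μ < ⊤ :=
  (entropy_le_coverEntropy_add_log_two hf).trans_lt (EReal.add_lt_top htop.ne (EReal.coe_ne_top _))

end TopologicalEntropy

section LargeWeights

variable {P ι : Type*} [TopologicalSpace P] {M : Set P} {h I : P → ℝ} {l : Filter ι} [l.NeBot]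
  {t : ι → ℝ} {ν : ι → P} {μ : P}

theorem isMaxOn_of_tendsto_isMaxOn_add_mul (husc : UpperSemicontinuousWithinAt h M μ)
    (hI : ContinuousAt I μ) (ht : Tendsto t l atTop) (hlim : Tendsto ν l (𝓝[M] μ))
    (hmax : ∀ᶠ i in l, IsMaxOn (fun ρ => h ρ + t i * I ρ) M (ν i)) : IsMaxOn I M μ := by
  intro ρ hρ
  have hbound : ∀ᶠ i in l, I ρ ≤ I (ν i) + (h μ + 1 - h ρ) / t i := by
    filter_upwards [hmax, ht.eventually_gt_atTop 0, hlim.eventually (husc _ (lt_add_one (h μ)))]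
      with i hi hti hνi
    have hρi : h ρ + t i * I ρ ≤ h (ν i) + t i * I (ν i) := hi hρ
    rw [← sub_le_iff_le_add', le_div_iff₀ hti]
    linarith
  have hconv : Tendsto (fun i => I (ν i) + (h μ + 1 - h ρ) / t i) l (𝓝 (I μ + 0)) :=
    (hI.tendsto.comp (hlim.mono_right nhdsWithin_le_nhds)).add (ht.const_div_atTop _)
  exact (ge_of_tendsto hconv hbound).trans_eq (add_zero _)

theorem isMaxOn_setOf_isMaxOn_of_tendsto_isMaxOn_add_mul
    (husc : UpperSemicontinuousWithinAt h M μ) (ht : ∀ᶠ i in l, 0 ≤ t i)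
    (hlim : Tendsto ν l (𝓝[M] μ))
    (hmax : ∀ᶠ i in l, IsMaxOn (fun ρ => h ρ + t i * I ρ) M (ν i)) :
    IsMaxOn h {ρ ∈ M | IsMaxOn I M ρ} μ := by
  rintro ρ ⟨hρ, hρI⟩
  by_contra hnot
  have hlt : h μ < h ρ := not_le.1 hnot
  obtain ⟨i, hi, hti, hνi, hνM⟩ := (hmax.and <| ht.and <| (hlim.eventually (husc _ hlt)).and <|
    hlim.eventually eventually_mem_nhdsWithin).exists
  have hρi : h ρ + t i * I ρ ≤ h (ν i) + t i * I (ν i) := hi hρ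
  have hIρ : t i * I (ν i) ≤ t i * I ρ := mul_le_mul_of_nonneg_left (hρI hνM) hti
  linarith

end LargeWeights

section EquilibriumStates

theorem eq_biSup_iff_isMaxOn {α β : Type*} [CompleteLattice β] {g : α → β} {s : Set α} {a : α}
    (ha : a ∈ s) : g a = ⨆ x ∈ s, g x ↔ IsMaxOn g s a :=
  ⟨fun h _ hx => (le_iSup₂ (f := fun x _ => g x) _ hx).trans_eq h.symm,
    fun h => le_antisymm (le_iSup₂ (f := fun x _ => g x) a ha) (iSup₂_le fun _ hx => h hx)⟩

variable {X : Type*} [MeasurableSpace X] {f : X → X}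

theorem mem_equilibriumStates_iff {φ : X → ℝ} {μ : ProbabilityMeasure X} :
    μ ∈ equilibriumStates f φ ↔
      μ ∈ invariantMeasures f ∧ IsMaxOn (freeEnergy f φ) (invariantMeasures f) μ :=
  and_congr_right eq_biSup_iff_isMaxOn

theorem mem_localizedMaxEntropyMeasures_iff {m : ℕ} {Φ : X → EuclideanSpace ℝ (Fin m)}
    {w : EuclideanSpace ℝ (Fin m)} {μ : ProbabilityMeasure X} :
    μ ∈ localizedMaxEntropyMeasures f Φ w ↔ μ ∈ rotationClass f Φ w ∧
      IsMaxOn (fun ν : ProbabilityMeasure X => entropy f (ν : Measure X))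
        (rotationClass f Φ w) μ :=
  and_congr_right <|
    eq_biSup_iff_isMaxOn (g := fun ν : ProbabilityMeasure X => entropy f (ν : Measure X))

theorem coe_toReal_entropy {μ : Measure X} [IsProbabilityMeasure μ] (hμ : entropy f μ < ⊤) :
    ((entropy f μ).toReal : EReal) = entropy f μ :=
  EReal.coe_toReal hμ.ne (EReal.bot_lt_zero.trans_le (entropy_nonneg f μ)).ne'

theorem isMaxOn_toReal_entropy_add_integral
    (hfin : ∀ μ ∈ invariantMeasures f, entropy f (μ : Measure X) < ⊤) {φ : X → ℝ}
    {μ : ProbabilityMeasure X} (hμ : μ ∈ equilibriumStates f φ) :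
    IsMaxOn (fun ν : ProbabilityMeasure X =>
      (entropy f (ν : Measure X)).toReal + ∫ x, φ x ∂(ν : Measure X)) (invariantMeasures f) μ := by
  obtain ⟨hμM, hmax⟩ := mem_equilibriumStates_iff.1 hμ
  intro ν hν
  have hle : freeEnergy f φ ν ≤ freeEnergy f φ μ := hmax hν
  rw [freeEnergy, freeEnergy, ← coe_toReal_entropy (hfin ν hν),
    ← coe_toReal_entropy (hfin μ hμM)] at hle
  exact_mod_cast hle

end EquilibriumStates

section WeakTopology

variable {X : Type*} [TopologicalSpace X] [MeasurableSpace X]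

theorem upperSemicontinuousOn_toReal_entropy [OpensMeasurableSpace X] {f : X → X}
    (hfin : ∀ μ ∈ invariantMeasures f, entropy f (μ : Measure X) < ⊤)
    (husc : UpperSemicontinuousOn (fun μ : ProbabilityMeasure X => entropy f (μ : Measure X))
      (invariantMeasures f)) :
    UpperSemicontinuousOn (fun μ : ProbabilityMeasure X => (entropy f (μ : Measure X)).toReal)
      (invariantMeasures f) := by
  intro μ hμ y hy
  have hlt : entropy f (μ : Measure X) < y := by
    rwa [← coe_toReal_entropy (hfin μ hμ), EReal.coe_lt_coe_iff]
  filter_upwards [husc μ hμ y hlt, eventually_mem_nhdsWithin] with ν hνy hν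
  rwa [← coe_toReal_entropy (hfin ν hν), EReal.coe_lt_coe_iff] at hνy

variable [CompactSpace X]

theorem continuous_integral [OpensMeasurableSpace X] {φ : X → ℝ} (hφ : Continuous φ) :
    Continuous fun μ : ProbabilityMeasure X => ∫ x, φ x ∂(μ : Measure X) :=
  ProbabilityMeasure.continuous_integral_boundedContinuousFunction
    (BoundedContinuousFunction.mkOfCompact ⟨φ, hφ⟩)

theorem isMaxOn_integral_and_isMaxOn_entropy_of_tendsto [OpensMeasurableSpace X] {f : X → X}
    (hfin : ∀ μ ∈ invariantMeasures f, entropy f (μ : Measure X) < ⊤)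
    (husc : UpperSemicontinuousOn (fun μ : ProbabilityMeasure X => entropy f (μ : Measure X))
      (invariantMeasures f))
    {φ : X → ℝ} (hφ : Continuous φ) {ι : Type*} {l : Filter ι} [l.NeBot] {t : ι → ℝ}
    (ht : Tendsto t l atTop) {ν : ι → ProbabilityMeasure X}
    (hν : ∀ᶠ i in l, ν i ∈ equilibriumStates f (fun x => t i * φ x)) {μ : ProbabilityMeasure X}
    (hμ : μ ∈ invariantMeasures f) (hlim : Tendsto ν l (𝓝 μ)) :
    let I := fun ρ : ProbabilityMeasure X => ∫ x, φ x ∂(ρ : Measure X)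
    IsMaxOn I (invariantMeasures f) μ ∧
      IsMaxOn (fun ρ : ProbabilityMeasure X => entropy f (ρ : Measure X))
        {ρ ∈ invariantMeasures f | IsMaxOn I (invariantMeasures f) ρ} μ := by
  intro I
  have husc' := upperSemicontinuousOn_toReal_entropy hfin husc μ hμ
  have hlim' : Tendsto ν l (𝓝[invariantMeasures f] μ) :=
    tendsto_nhdsWithin_iff.2 ⟨hlim, hν.mono fun i hi => hi.1⟩
  have hmax : ∀ᶠ i in l, IsMaxOn (fun ρ : ProbabilityMeasure X =>
      (entropy f (ρ : Measure X)).toReal + t i * I ρ) (invariantMeasures f) (ν i) :=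
    hν.mono fun i hi => by
      simpa only [integral_const_mul] using isMaxOn_toReal_entropy_add_integral hfin hi
  refine ⟨isMaxOn_of_tendsto_isMaxOn_add_mul husc' (continuous_integral hφ).continuousAt ht
    hlim' hmax, fun ρ hρ => ?_⟩
  have hle := isMaxOn_setOf_isMaxOn_of_tendsto_isMaxOn_add_mul husc' (ht.eventually_ge_atTop 0)
    hlim' hmax hρ
  change entropy f (ρ : Measure X) ≤ entropy f (μ : Measure X)
  rw [← coe_toReal_entropy (hfin ρ hρ.1), ← coe_toReal_entropy (hfin μ hμ)]
  exact EReal.coe_le_coe hle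

variable [T2Space X] [HasOuterApproxClosed X] [BorelSpace X] {f : X → X}

theorem isCompact_invariantMeasures (hf : Continuous f) : IsCompact (invariantMeasures f) := by
  have hfixed : invariantMeasures f =
      {μ : ProbabilityMeasure X | μ.map hf.measurable.aemeasurable = μ} := by
    ext μ
    refine ⟨fun h => Subtype.ext (by simpa using MeasurePreserving.map_eq h),
      fun h => ⟨hf.measurable, ?_⟩⟩
    simpa using congrArg (fun ν : ProbabilityMeasure X => (ν : Measure X)) h
  rw [hfixed]
  exact (isClosed_eq (ProbabilityMeasure.continuous_map hf) continuous_id).isCompact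

theorem equilibriumStates_nonempty (hf : Continuous f)
    (husc : UpperSemicontinuousOn (fun μ : ProbabilityMeasure X => entropy f (μ : Measure X))
      (invariantMeasures f))
    (hne : (invariantMeasures f).Nonempty) {φ : X → ℝ} (hφ : Continuous φ) :
    (equilibriumStates f φ).Nonempty := by
  have hint : Continuous fun μ : ProbabilityMeasure X =>
      ((∫ x, φ x ∂(μ : Measure X) : ℝ) : EReal) :=
    continuous_coe_real_ereal.comp (continuous_integral hφ)
  have hfree : UpperSemicontinuousOn (freeEnergy f φ) (invariantMeasures f) :=
    husc.add' (hint.upperSemicontinuous.upperSemicontinuousOn _) fun μ _ =>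
      EReal.continuousAt_add (Or.inr (EReal.coe_ne_bot _)) (Or.inr (EReal.coe_ne_top _))
  obtain ⟨μ, hμ, hmax⟩ := hfree.exists_isMaxOn hne (isCompact_invariantMeasures hf)
  exact ⟨μ, mem_equilibriumStates_iff.2 ⟨hμ, hmax⟩⟩

end WeakTopology

section Rotation

variable {m : ℕ} {w α : EuclideanSpace ℝ (Fin m)}

theorem inter_supportingHyperplane_eq {K : Set (EuclideanSpace ℝ (Fin m))}
    (hw : w ∈ K ∩ supportingHyperplane K α) :
    K ∩ supportingHyperplane K α = {v ∈ K | IsMaxOn (inner ℝ α) K v} := by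
  obtain ⟨hwK, a, hsupp, hle, hwa⟩ := hw
  ext v
  refine and_congr_right fun hv => ⟨?_, fun hmax => ?_⟩
  · rintro ⟨b, -, hleb, hvb⟩ u hu
    exact (not_lt.1 (hleb u hu)).trans_eq hvb.symm
  · exact ⟨a, hsupp, hle, le_antisymm (not_lt.1 (hle v hv)) (hwa.symm.trans_le (hmax hwK))⟩

variable {X : Type*} [TopologicalSpace X] {Φ : X → EuclideanSpace ℝ (Fin m)}

theorem continuous_dotPotential (hΦ : Continuous Φ) (α : EuclideanSpace ℝ (Fin m)) :
    Continuous (dotPotential α Φ) :=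
  continuous_const.inner hΦ

variable [CompactSpace X] [MeasurableSpace X]

theorem integral_dotPotential [OpensMeasurableSpace X] (hΦ : Continuous Φ)
    (α : EuclideanSpace ℝ (Fin m)) (μ : ProbabilityMeasure X) :
    ∫ x, dotPotential α Φ x ∂(μ : Measure X) = inner ℝ α (rv Φ μ) := by
  have hint : Integrable Φ (μ : Measure X) :=
    hΦ.integrable_of_hasCompactSupport (HasCompactSupport.of_compactSpace Φ)
  have hrv : rv Φ μ = ∫ x, Φ x ∂(μ : Measure X) := by
    ext i
    exact (eval_integral_piLp (fun i => hint.eval_piLp i) i).symm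
  simp only [dotPotential]
  rw [integral_inner hint, hrv]

theorem setOf_isMaxOn_integral_dotPotential_eq_rotationClass [OpensMeasurableSpace X] {f : X → X}
    (hΦ : Continuous Φ) (hface : face f Φ α = {w}) :
    {ρ ∈ invariantMeasures f | IsMaxOn (fun ρ : ProbabilityMeasure X =>
      ∫ x, dotPotential α Φ x ∂(ρ : Measure X)) (invariantMeasures f) ρ} =
        rotationClass f Φ w := by
  have hmaximizers : {v ∈ Rot f Φ | IsMaxOn (inner ℝ α) (Rot f Φ) v} = {w} :=
    hface ▸ (inter_supportingHyperplane_eq (hface.symm ▸ Set.mem_singleton w)).symm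
  ext ρ
  refine and_congr_right fun hρ => ?_
  calc IsMaxOn (fun ρ : ProbabilityMeasure X => ∫ x, dotPotential α Φ x ∂(ρ : Measure X))
        (invariantMeasures f) ρ
      ↔ IsMaxOn (inner ℝ α) (Rot f Φ) (rv Φ ρ) := by
        simp only [isMaxOn_iff, integral_dotPotential hΦ, Rot, Set.forall_mem_image]
    _ ↔ rv Φ ρ ∈ {v ∈ Rot f Φ | IsMaxOn (inner ℝ α) (Rot f Φ) v} :=
        (and_iff_right (Set.mem_image_of_mem _ hρ)).symm
    _ ↔ rv Φ ρ = w := by rw [hmaximizers, Set.mem_singleton_iff]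

section ZeroTemperatureLimits

variable {f : X → X} {ι : Type*} {l : Filter ι} {t : ι → ℝ} {ν : ι → ProbabilityMeasure X}
  {μ : ProbabilityMeasure X}

theorem mem_localizedMaxEntropyMeasures_of_tendsto [OpensMeasurableSpace X]
    (hfin : ∀ μ ∈ invariantMeasures f, entropy f (μ : Measure X) < ⊤)
    (husc : UpperSemicontinuousOn (fun μ : ProbabilityMeasure X => entropy f (μ : Measure X))
      (invariantMeasures f))
    (hΦ : Continuous Φ) (hface : face f Φ α = {w}) [l.NeBot] (ht : Tendsto t l atTop)
    (hν : ∀ᶠ i in l, ν i ∈ equilibriumStates f (fun x => t i * dotPotential α Φ x))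
    (hμ : μ ∈ invariantMeasures f) (hlim : Tendsto ν l (𝓝 μ)) :
    μ ∈ localizedMaxEntropyMeasures f Φ w := by
  obtain ⟨hintegral, hentropy⟩ := isMaxOn_integral_and_isMaxOn_entropy_of_tendsto hfin husc
    (continuous_dotPotential hΦ α) ht hν hμ hlim
  rw [setOf_isMaxOn_integral_dotPotential_eq_rotationClass hΦ hface] at hentropy
  exact mem_localizedMaxEntropyMeasures_iff.2
    ⟨setOf_isMaxOn_integral_dotPotential_eq_rotationClass hΦ hface ▸ ⟨hμ, hintegral⟩, hentropy⟩

variable [T2Space X] [HasOuterApproxClosed X] [BorelSpace X]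

theorem tendsto_of_localizedMaxEntropyMeasures_eq_singleton (hf : Continuous f)
    (hfin : ∀ μ ∈ invariantMeasures f, entropy f (μ : Measure X) < ⊤)
    (husc : UpperSemicontinuousOn (fun μ : ProbabilityMeasure X => entropy f (μ : Measure X))
      (invariantMeasures f))
    (hΦ : Continuous Φ) (hface : face f Φ α = {w})
    (hμ : localizedMaxEntropyMeasures f Φ w = {μ}) (ht : Tendsto t l atTop)
    (hν : ∀ᶠ i in l, ν i ∈ equilibriumStates f (fun x => t i * dotPotential α Φ x)) :
    Tendsto ν l (𝓝 μ) := by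
  refine (isCompact_invariantMeasures hf).tendsto_nhds_of_unique_mapClusterPt
    (hν.mono fun i hi => hi.1) fun ρ hρ hcluster => ?_
  obtain ⟨U, hU, hlim⟩ := mapClusterPt_iff_ultrafilter.1 hcluster
  have hmem := mem_localizedMaxEntropyMeasures_of_tendsto hfin husc hΦ hface (ht.mono_left hU)
    (hν.filter_mono hU) hρ hlim
  rwa [hμ] at hmem

end ZeroTemperatureLimits

end Rotation

end RotEntropy

open RotEntropy in
theorem corollary4_general {X : Type*} [TopologicalSpace X] [CompactSpace X] [T2Space X]
    [HasOuterApproxClosed X] [MeasurableSpace X] [BorelSpace X] {f : X → X} (hf : Continuous f)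
    (hfin : ∀ μ ∈ invariantMeasures f, entropy f (μ : Measure X) < ⊤)
    (husc : UpperSemicontinuousOn (fun μ : ProbabilityMeasure X => entropy f (μ : Measure X))
      (invariantMeasures f))
    {m : ℕ} {Φ : X → EuclideanSpace ℝ (Fin m)} (hΦ : Continuous Φ)
    {w α : EuclideanSpace ℝ (Fin m)} (hface : face f Φ α = {w}) :
    groundStates f (dotPotential α Φ) ⊆ localizedMaxEntropyMeasures f Φ w ∧
      ∀ μ, localizedMaxEntropyMeasures f Φ w = {μ} →
        groundStates f (dotPotential α Φ) = {μ} ∧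
        ((∃ t₀ : ℝ, ∀ t, t₀ ≤ t → ∃ ν,
            equilibriumStates f (fun x => t * dotPotential α Φ x) = {ν}) →
          IsZeroTemperatureMeasure f (dotPotential α Φ) μ) := by
  have hsubset : groundStates f (dotPotential α Φ) ⊆ localizedMaxEntropyMeasures f Φ w :=
    fun _ ⟨hμ, _, _, _, ht, hν, hlim⟩ =>
      mem_localizedMaxEntropyMeasures_of_tendsto hfin husc hΦ hface ht (.of_forall hν) hμ hlim
  refine ⟨hsubset, fun μ hμ => ?_⟩
  have hμM : μ ∈ invariantMeasures f := (hμ.symm ▸ Set.mem_singleton μ :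
    μ ∈ localizedMaxEntropyMeasures f Φ w).1.1
  refine ⟨(hsubset.trans_eq hμ).antisymm (Set.singleton_subset_iff.2 ⟨hμM, ?_⟩), ?_⟩
  · choose ν hν using fun n : ℕ => equilibriumStates_nonempty hf husc ⟨μ, hμM⟩
      ((continuous_dotPotential hΦ α).const_mul (n : ℝ))
    exact ⟨Nat.cast, ν, Nat.strictMono_cast, tendsto_natCast_atTop_atTop, hν,
      tendsto_of_localizedMaxEntropyMeasures_eq_singleton hf hfin husc hΦ hface hμ
        tendsto_natCast_atTop_atTop (.of_forall hν)⟩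
  · rintro ⟨t₀, ht₀⟩
    have : Nonempty (ProbabilityMeasure X) := ⟨μ⟩
    choose! ν hν using ht₀
    refine ⟨hμM, max t₀ 0, ν, le_max_right _ _, fun t ht => hν t (le_of_max_le_left ht), ?_⟩
    exact tendsto_of_localizedMaxEntropyMeasures_eq_singleton hf hfin husc hΦ hface hμ tendsto_id
      ((eventually_ge_atTop t₀).mono fun t ht => hν t ht ▸ Set.mem_singleton (ν t))

theorem corollary4 {X : Type*} [MetricSpace X] [CompactSpace X] [MeasurableSpace X] [BorelSpace X]
    (f : X → X) (hf : Continuous f)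
    (htop : Dynamics.coverEntropy f Set.univ < ⊤)
    (husc : UpperSemicontinuousOn
      (fun μ : ProbabilityMeasure X => RotEntropy.entropy f (μ : Measure X))
      (RotEntropy.invariantMeasures f))
    (m : ℕ) (Φ : X → EuclideanSpace ℝ (Fin m)) (hΦ : Continuous Φ)
    (w : EuclideanSpace ℝ (Fin m)) (hw : w ∈ frontier (RotEntropy.Rot f Φ))
    (hexp : RotEntropy.IsExposedPoint (RotEntropy.Rot f Φ) w) :
    (∀ α ∈ RotEntropy.directionVectors f Φ w, RotEntropy.face f Φ α = {w} →
      ∀ μ ∈ RotEntropy.groundStates f (RotEntropy.dotPotential α Φ),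
        RotEntropy.rv Φ μ = w ∧
          RotEntropy.entropy f (μ : Measure X) =
            ⨆ ν ∈ RotEntropy.rotationClass f Φ w, RotEntropy.entropy f (ν : Measure X)) ∧
    (∀ μ : ProbabilityMeasure X, RotEntropy.localizedMaxEntropyMeasures f Φ w = {μ} →
      ∀ α ∈ RotEntropy.directionVectors f Φ w, RotEntropy.face f Φ α = {w} →
        RotEntropy.groundStates f (RotEntropy.dotPotential α Φ) = {μ} ∧
        ((∃ t₀ : ℝ, ∀ t, t₀ ≤ t → ∃ ν : ProbabilityMeasure X,
            RotEntropy.equilibriumStates f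
              (fun x => t * RotEntropy.dotPotential α Φ x) = {ν}) →
          RotEntropy.IsZeroTemperatureMeasure f (RotEntropy.dotPotential α Φ) μ)) := by
  have general := fun α (hα : RotEntropy.face f Φ α = {w}) =>
    corollary4_general hf (fun μ hμ => RotEntropy.entropy_lt_top hμ htop) husc hΦ hα
  exact ⟨fun α _ hα μ hμ => ⟨((general α hα).1 hμ).1.2, ((general α hα).1 hμ).2⟩,
    fun μ hμ α _ hα => (general α hα).2 μ hμ⟩
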